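/- **Theorem 4.2.** A *quadratic space* is a finite-dimensional $\mathbb{F}_2$-vector space $V$ with a quadratic form $q_V : V \to \mathbb{F}_2$, possibly degenerate; let $O(V)$ be the group of linear automorphisms of $V$ preserving $q_V$. Let $\mathcal{E}_q^{\mathrm{deg}}$ be the category of quadratic spaces and injective linear maps preserving the forms; it has pullbacks. Let $\mathrm{Sp}(\mathcal{E}_q^{\mathrm{deg}})$ be the category with the same objects, whose morphisms $V \to W$ are the isomorphism classes $[V \leftarrow D \to W]$ of spans in $\mathcal{E}_q^{\mathrm{deg}}$, composed by pullback. Let $\mathcal{F}_{iso}$ be the category of all functors from $\mathrm{Sp}(\mathcal{E}_q^{\mathrm{deg}})$ to $\mathbb{F}_2$-vector spaces. For $F \in \mathcal{F}_{iso}$ and a quadratic space $V$ put $$\Phi_V(F) = \{x \in F(V) : F([V \xleftarrow{\alpha} A \xrightarrow{\alpha} V])(x) = 0 \text{ for every non-surjective } \alpha : A \to V \text{ in } \mathcal{E}_q^{\mathrm{deg}}\},$$ a left $\mathbb{F}_2[O(V)]$-module on which $g \in O(V)$ acts by $F([V \xleftarrow{\mathrm{id}} V \xrightarrow{g} V])$.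 Let $\mathcal{S}$ be a set of representatives of the isometry classes of quadratic spaces. Then there is an equivalence of categories $$\mathcal{F}_{iso} \simeq \prod_{V \in \mathcal{S}} \mathbb{F}_2[O(V)]\text{-mod},$$ whose functor from left to right is naturally isomorphic to $F \mapsto (\Phi_V(F))_{V \in \mathcal{S}}$. For $V \in \mathcal{S}$ and an $\mathbb{F}_2[O(V)]$-module $M$, let $L(V, M) \in \mathcal{F}_{iso}$ be the image, under the inverse equivalence, of the family equal to $M$ at $V$ and $0$ elsewhere. Then the simple objects of $\mathcal{F}_{iso}$ are classified as follows: 1. if $M$ is a simple $\mathbb{F}_2[O(V)]$-module, then $L(V, M)$ is simple; 2. for every simple $F \in \mathcal{F}_{iso}$ there is exactly one $V \in \mathcal{S}$ such that $F \cong L(V, M)$ for some simple $\mathbb{F}_2[O(V)]$-module $M$; 3. if $L(V, M) \cong L(V, N)$, then $M \cong N$. -/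

import Mathlib

open CategoryTheory CategoryTheory.Limits

universe u v

/-! ### Categories of spans -/

section Spans

variable {C : Type u} [Category.{v} C]

instance topHasPullbacksAgainstTop [HasPullbacks C] :
    (⊤ : MorphismProperty C).HasPullbacksAgainst ⊤ where
  hasPullbacksAlong _ _ := inferInstance

instance topStableAlong {X Y : C} (f : X ⟶ Y) :
    (⊤ : MorphismProperty C).IsStableUnderBaseChangeAlong f where
  of_isPullback _ _ := trivial

instance topStableAgainstTop :
    (⊤ : MorphismProperty C).IsStableUnderBaseChangeAgainst ⊤ where
  isStableUnderBaseChangeAlong _ _ := inferInstance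

/-- Spans `A ⟵ D ⟶ B` in a category, with no condition on the two legs. -/
abbrev PlainSpan (A B : C) := Span (⊤ : MorphismProperty C) (⊤ : MorphismProperty C) A B

/-- The span with apex `D` and legs `l`, `r`. -/
abbrev PlainSpan.mk' {A B D : C} (l : D ⟶ A) (r : D ⟶ B) : PlainSpan A B :=
  ⟨D, l, r, trivial, trivial⟩

variable (C) in
/-- The category `Sp(C)`: same objects as `C`, the morphisms from `A` to `B` are the isomorphism
classes of spans `A ⟵ D ⟶ B`, composed by pullback. -/
structure Sp where
  /-- the underlying object -/
  obj : C

namespace Sp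

/-- The class of the span `A ⟵ D ⟶ B` with legs `l` and `r`. -/
def cls {A B D : C} (l : D ⟶ A) (r : D ⟶ B) :
    Quotient (isIsomorphicSetoid (PlainSpan A B)) :=
  Quotient.mk _ (PlainSpan.mk' l r)

theorem cls_eq {A B D D' : C} {l : D ⟶ A} {r : D ⟶ B} {l' : D' ⟶ A} {r' : D' ⟶ B}
    (e : D ≅ D') (hl : e.hom ≫ l' = l) (hr : e.hom ≫ r' = r) : cls l r = cls l' r' :=
  Quotient.sound ⟨Span.mkIso e hl hr⟩

variable [HasPullbacks C]

theorem comp_rel {A B E : C} {S S' : PlainSpan A B} {T T' : PlainSpan B E}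
    (h : S ≅ S') (k : T ≅ T') : Nonempty (S.comp T ≅ S'.comp T') := by
  have h1 : h.hom.hom ≫ h.inv.hom = 𝟙 _ := congrArg Span.Hom.hom h.hom_inv_id
  have h2 : h.inv.hom ≫ h.hom.hom = 𝟙 _ := congrArg Span.Hom.hom h.inv_hom_id
  have k1 : k.hom.hom ≫ k.inv.hom = 𝟙 _ := congrArg Span.Hom.hom k.hom_inv_id
  have k2 : k.inv.hom ≫ k.hom.hom = 𝟙 _ := congrArg Span.Hom.hom k.inv_hom_id
  let a : S.apex ≅ S'.apex := ⟨h.hom.hom, h.inv.hom, h1, h2⟩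
  let b : T.apex ≅ T'.apex := ⟨k.hom.hom, k.inv.hom, k1, k2⟩
  have ca : S.r ≫ 𝟙 B = a.hom ≫ S'.r := by simp [a]
  have cb : T.l ≫ 𝟙 B = b.hom ≫ T'.l := by simp [b]
  have : IsIso a.hom := a.isIso_hom
  have : IsIso b.hom := b.isIso_hom
  let i : pullback S.r T.l ≅ pullback S'.r T'.l :=
    asIso (pullback.map S.r T.l S'.r T'.l a.hom b.hom (𝟙 B) ca cb)
  have hi1 : i.hom ≫ pullback.fst S'.r T'.l = pullback.fst S.r T.l ≫ a.hom :=
    pullback.lift_fst _ _ _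
  have hi2 : i.hom ≫ pullback.snd S'.r T'.l = pullback.snd S.r T.l ≫ b.hom :=
    pullback.lift_snd _ _ _
  refine ⟨Span.mkIso i ?_ ?_⟩
  · change i.hom ≫ pullback.fst S'.r T'.l ≫ S'.l = pullback.fst S.r T.l ≫ S.l
    rw [← Category.assoc, hi1, Category.assoc, show a.hom ≫ S'.l = S.l from h.hom.hom_l]
  · change i.hom ≫ pullback.snd S'.r T'.l ≫ T'.r = pullback.snd S.r T.l ≫ T.r
    rw [← Category.assoc, hi2, Category.assoc, show b.hom ≫ T'.r = T.r from k.hom.hom_r]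

/-- Composition of classes of spans, induced by `CategoryTheory.Span.comp`. -/
noncomputable def comp {A B E : C} (f : Quotient (isIsomorphicSetoid (PlainSpan A B)))
    (g : Quotient (isIsomorphicSetoid (PlainSpan B E))) :
    Quotient (isIsomorphicSetoid (PlainSpan A E)) :=
  Quotient.map₂ (fun S T => S.comp T)
    (fun _ _ h _ _ k => comp_rel (Classical.choice h) (Classical.choice k)) f g

/-- Composition may be computed with any pullback square. -/
theorem comp_cls {A B E D D' P : C} {l : D ⟶ A} {r : D ⟶ B} {l' : D' ⟶ B} {r' : D' ⟶ E}
    {p : P ⟶ D} {q : P ⟶ D'} (h : IsPullback p q r l') :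
    comp (cls l r) (cls l' r') = cls (p ≫ l) (q ≫ r') := by
  refine (cls_eq h.isoPullback ?_ ?_).symm
  · simp
  · simp

noncomputable instance : Category (Sp C) where
  Hom A B := Quotient (isIsomorphicSetoid (PlainSpan A.obj B.obj))
  id A := cls (𝟙 A.obj) (𝟙 A.obj)
  comp f g := comp f g
  id_comp f := by
    induction f using Quotient.inductionOn with | _ S =>
    exact (comp_cls (l := 𝟙 _) (r := 𝟙 _) (l' := S.l) (r' := S.r) (p := S.l) (q := 𝟙 _)
      (IsPullback.of_vert_isIso ⟨by simp⟩)).trans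
      (cls_eq (Iso.refl _) (by simp) (by simp))
  comp_id f := by
    induction f using Quotient.inductionOn with | _ S =>
    exact (comp_cls (l := S.l) (r := S.r) (l' := 𝟙 _) (r' := 𝟙 _) (p := 𝟙 _) (q := S.r)
      (IsPullback.of_horiz_isIso ⟨by simp⟩)).trans
      (cls_eq (Iso.refl _) (by simp) (by simp))
  assoc f g h := by
    induction f using Quotient.inductionOn with | _ S =>
    induction g using Quotient.inductionOn with | _ T =>
    induction h using Quotient.inductionOn with | _ U =>
    have hP := IsPullback.of_hasPullback (pullback.snd S.r T.l) (pullback.fst T.r U.l)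
    have hST := IsPullback.of_hasPullback S.r T.l
    have hTU := IsPullback.of_hasPullback T.r U.l
    have h1 := comp_cls (l := pullback.fst S.r T.l ≫ S.l) (r' := U.r)
      (hP.paste_vert hTU)
    have h2 := comp_cls (l := S.l) (r' := pullback.snd T.r U.l ≫ U.r)
      (hP.paste_horiz hST)
    exact h1.trans ((cls_eq (Iso.refl _) (by simp) (by simp)).trans h2.symm)

end Sp
end Spans

/-! ### Quadratic spaces over `𝔽₂` -/

/-- A finite dimensional `𝔽₂`-vector space with a quadratic form, possibly degenerate. -/
structure QuadSpace where
  /-- the underlying vector space -/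
  carrier : Type u
  [addCommGroup : AddCommGroup carrier]
  [module : Module (ZMod 2) carrier]
  [finite : Module.Finite (ZMod 2) carrier]
  /-- the quadratic form -/
  form : QuadraticForm (ZMod 2) carrier

namespace QuadSpace

attribute [instance] addCommGroup module finite

instance : CoeSort QuadSpace.{u} (Type u) := ⟨carrier⟩

/-- Injective linear maps preserving the quadratic forms. -/
@[ext]
structure Hom (V W : QuadSpace.{u}) where
  /-- the underlying form-preserving linear map -/
  toIsometry : V.form →qᵢ W.form
  injective : Function.Injective toIsometry

/-- The category of possibly degenerate quadratic spaces. -/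
instance : Category QuadSpace.{u} where
  Hom := Hom
  id V := ⟨QuadraticMap.Isometry.id V.form, fun _ _ h => h⟩
  comp f g := ⟨g.toIsometry.comp f.toIsometry, g.injective.comp f.injective⟩

theorem hom_ext {V W : QuadSpace.{u}} {f g : V ⟶ W}
    (h : ∀ x, f.toIsometry x = g.toIsometry x) : f = g :=
  Hom.ext (QuadraticMap.Isometry.ext h)

theorem comp_apply {U V W : QuadSpace.{u}} (f : U ⟶ V) (g : V ⟶ W) (x : U) :
    (f ≫ g).toIsometry x = g.toIsometry (f.toIsometry x) := rfl

section Pullback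

variable {A B V : QuadSpace.{u}} (f : A ⟶ V) (g : B ⟶ V)

/-- The pullback of `f` and `g`: the subspace of `A` of the vectors with image in `g(B)`. -/
def pb : QuadSpace.{u} where
  carrier := (LinearMap.range g.toIsometry.toLinearMap).comap f.toIsometry.toLinearMap
  form := A.form.comp (Submodule.subtype _)

/-- The projection to the first factor. -/
def pbFst : pb f g ⟶ A :=
  ⟨⟨Submodule.subtype _, fun _ => rfl⟩, Subtype.val_injective⟩

/-- The second projection as a function. -/
noncomputable def pbSndFun (x : pb f g) : B := x.2.choose

theorem pbSndFun_spec (x : pb f g) :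
    g.toIsometry (pbSndFun f g x) = f.toIsometry x.1 := x.2.choose_spec

/-- The projection to the second factor. -/
noncomputable def pbSnd : pb f g ⟶ B where
  toIsometry :=
    { toFun := pbSndFun f g
      map_add' := fun x y => g.injective (by
        simp only [map_add, pbSndFun_spec]
        exact map_add f.toIsometry x.1 y.1)
      map_smul' := fun c x => g.injective (by
        simp only [map_smul, pbSndFun_spec, RingHom.id_apply]
        exact map_smul f.toIsometry c x.1)
      map_app' := fun x => by
        change B.form (pbSndFun f g x) = A.form x.1
        rw [← g.toIsometry.map_app, pbSndFun_spec, f.toIsometry.map_app] }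
  injective := fun x y h => Subtype.ext (f.injective (by
    rw [← pbSndFun_spec f g x, ← pbSndFun_spec f g y]
    exact congrArg g.toIsometry h))

theorem pb_comm : pbFst f g ≫ f = pbSnd f g ≫ g :=
  hom_ext fun x => (pbSndFun_spec f g x).symm

/-- The morphism to the pullback given by a commutative square. -/
def pbLift {X : QuadSpace.{u}} (a : X ⟶ A) (b : X ⟶ B) (h : a ≫ f = b ≫ g) : X ⟶ pb f g where
  toIsometry :=
    { toFun := fun x => ⟨a.toIsometry x, b.toIsometry x,
        (congrArg (fun k : X ⟶ V => k.toIsometry x) h).symm⟩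
      map_add' := fun x y => Subtype.ext (map_add a.toIsometry x y)
      map_smul' := fun c x => Subtype.ext (map_smul a.toIsometry c x)
      map_app' := fun x => a.toIsometry.map_app x }
  injective := fun _ _ h => a.injective (congrArg Subtype.val h)

theorem isPullback_pb : IsPullback (pbFst f g) (pbSnd f g) f g :=
  ⟨⟨pb_comm f g⟩, ⟨PullbackCone.IsLimit.mk _ (fun s => pbLift f g s.fst s.snd s.condition)
    (fun _ => rfl)
    (fun s => hom_ext fun x => g.injective
      ((pbSndFun_spec f g _).trans
        (congrArg (fun k : s.pt ⟶ V => k.toIsometry x) s.condition)))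
    (fun s _ h _ => hom_ext fun x => Subtype.ext
      (congrArg (fun k : s.pt ⟶ A => k.toIsometry x) h))⟩⟩

instance : HasPullbacks QuadSpace.{u} :=
  @hasPullbacks_of_hasLimit_cospan _ _ fun {_ _ _ f g} => (isPullback_pb f g).hasPullback

end Pullback

/-- The orthogonal group `O(V)`: the linear automorphisms of `V` preserving the quadratic form. -/
def orthogonalGroup (V : QuadSpace.{u}) : Subgroup (V ≃ₗ[ZMod 2] V) where
  carrier := {g | ∀ x, V.form (g x) = V.form x}
  one_mem' _ := rfl
  mul_mem' {a b} ha hb x := (ha (b x)).trans (hb x)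
  inv_mem' {a} ha x := by
    have h := ha (a.symm x)
    rw [LinearEquiv.apply_symm_apply] at h
    exact h.symm

/-- An element of `O(V)` as an endomorphism of `V` in the category of quadratic spaces. -/
def orthogonalHom {V : QuadSpace.{u}} (g : V.orthogonalGroup) : V ⟶ V :=
  ⟨⟨(g.1 : V →ₗ[ZMod 2] V), g.2⟩, g.1.injective⟩

end QuadSpace

/-! ### The category `𝓕_iso` and the functors to modules over orthogonal groups -/

/-- The category `𝓕_iso` of functors from `Sp(QuadSpace)` to `𝔽₂`-vector spaces. -/
abbrev Fiso := Sp QuadSpace.{u} ⥤ ModuleCat.{u} (ZMod 2)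

namespace Fiso

open QuadSpace

/-- The morphism `[V ⟵ A ⟶ W]` of `Sp(QuadSpace)`. -/
def spanHom {A V W : QuadSpace.{u}} (l : A ⟶ V) (r : A ⟶ W) :
    (Sp.mk V : Sp QuadSpace.{u}) ⟶ Sp.mk W :=
  Sp.cls l r

/-- The idempotent `e_α = [V ⟵ A ⟶ V]`, both legs being `α`. -/
abbrev idem {A V : QuadSpace.{u}} (α : A ⟶ V) :
    (Sp.mk V : Sp QuadSpace.{u}) ⟶ Sp.mk V :=
  spanHom α α

/-- The isometry `g` of `V` as the endomorphism `[V ⟵ V ⟶ V]` with legs `id` and `g`. -/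
abbrev isom {V : QuadSpace.{u}} (g : V.orthogonalGroup) :
    (Sp.mk V : Sp QuadSpace.{u}) ⟶ Sp.mk V :=
  spanHom (𝟙 V) (orthogonalHom g)

theorem isom_one (V : QuadSpace.{u}) : isom (1 : V.orthogonalGroup) = 𝟙 _ := rfl

theorem isom_mul {V : QuadSpace.{u}} (g h : V.orthogonalGroup) :
    isom (g * h) = isom h ≫ isom g :=
  ((Sp.comp_cls (l := 𝟙 V) (r := orthogonalHom h) (l' := 𝟙 V) (r' := orthogonalHom g)
    (p := 𝟙 V) (q := orthogonalHom h) (IsPullback.of_horiz_isIso ⟨by simp⟩)).trans rfl).symm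

theorem isom_idem {A V : QuadSpace.{u}} (g : V.orthogonalGroup) (α : A ⟶ V) :
    isom g ≫ idem α = idem (α ≫ orthogonalHom g⁻¹) ≫ isom g := by
  have e1 : orthogonalHom g⁻¹ ≫ orthogonalHom g = 𝟙 V :=
    hom_ext fun x => g.1.apply_symm_apply x
  have e2 : orthogonalHom g ≫ orthogonalHom g⁻¹ = 𝟙 V :=
    hom_ext fun x => g.1.symm_apply_apply x
  have : IsIso (orthogonalHom g) := ⟨_, e2, e1⟩
  refine (Sp.comp_cls (p := α ≫ orthogonalHom g⁻¹) (q := 𝟙 A)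
    (IsPullback.of_vert_isIso ⟨by simp [e1]⟩)).trans ?_
  refine Eq.trans ?_ (Sp.comp_cls (p := 𝟙 A) (q := α ≫ orthogonalHom g⁻¹)
    (IsPullback.of_horiz_isIso ⟨by simp⟩)).symm
  exact Sp.cls_eq (Iso.refl _) (by simp) (by simp [e1])

/-- The subspace of the `x ∈ F(V)` with `F(e_α)(x) = 0` for all `α : A ⟶ V` that are not
surjective, that is, for all proper subobjects of `V`. -/
def primitive (V : QuadSpace.{u}) (F : Fiso.{u}) : Submodule (ZMod 2) (F.obj ⟨V⟩) where
  carrier := {x | ∀ (A : QuadSpace.{u}) (α : A ⟶ V),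
    ¬ Function.Surjective α.toIsometry → (F.map (idem α)).hom x = 0}
  zero_mem' _ _ _ := map_zero _
  add_mem' hx hy A α h := by rw [map_add, hx A α h, hy A α h, add_zero]
  smul_mem' c x hx A α h := by rw [map_smul, hx A α h, smul_zero]

theorem isom_mem {V : QuadSpace.{u}} {F : Fiso.{u}} (g : V.orthogonalGroup)
    {x : F.obj ⟨V⟩} (hx : x ∈ primitive V F) : (F.map (isom g)).hom x ∈ primitive V F := by
  intro A α h
  have key := congrArg (fun k => (F.map k).hom x) (isom_idem g α)
  simp only [F.map_comp, ModuleCat.hom_comp, LinearMap.comp_apply] at key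
  rw [key, hx A _ fun hs => h fun y => ?_, map_zero]
  obtain ⟨a, ha⟩ := hs (g.1.symm y)
  exact ⟨a, g.1.symm.injective ha⟩

theorem map_mem {V : QuadSpace.{u}} {F G : Fiso.{u}} (η : F ⟶ G)
    {x : F.obj ⟨V⟩} (hx : x ∈ primitive V F) : (η.app ⟨V⟩).hom x ∈ primitive V G := by
  intro A α h
  have key := congrArg (fun k => k.hom x) (η.naturality (idem α))
  simp only [ModuleCat.hom_comp, LinearMap.comp_apply] at key
  rw [← key, hx A α h, map_zero]

/-- `O(V)` acts on `primitive V F` through `F`: the isometry `g` acts as `F([V ⟵ V ⟶ V])` with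
legs `id` and `g`. -/
def primitiveRep (V : QuadSpace.{u}) (F : Fiso.{u}) :
    Representation (ZMod 2) V.orthogonalGroup (primitive V F) where
  toFun g := (F.map (isom g)).hom.restrict fun _ hx => isom_mem g hx
  map_one' := LinearMap.ext fun x => Subtype.ext (by
    simp [isom_one])
  map_mul' g h := LinearMap.ext fun x => Subtype.ext (by
    simp [isom_mul])

/-- The functor `F ↦ primitive V F` from `𝓕_iso` to representations of `O(V)`. -/
def primitiveRepFunctor (V : QuadSpace.{u}) :
    Fiso.{u} ⥤ Rep.{u} (ZMod 2) V.orthogonalGroup where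
  obj F := Rep.of (primitiveRep V F)
  map {F G} η := Rep.ofHom
    ⟨(η.app ⟨V⟩).hom.restrict fun _ hx => map_mem η hx, fun g => LinearMap.ext fun x =>
      Subtype.ext (congrArg (fun k => k.hom x.1) (η.naturality (isom g)))⟩

/-- The functor `F ↦ primitive V F` from `𝓕_iso` to modules over `𝔽₂[O(V)]`. -/
noncomputable def primitiveFunctor (V : QuadSpace.{u}) :
    Fiso.{u} ⥤ ModuleCat.{u} (MonoidAlgebra (ZMod 2) V.orthogonalGroup) :=
  primitiveRepFunctor V ⋙ Rep.toModuleMonoidAlgebra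

/-- `S` is a set of representatives of the isometry classes of quadratic spaces. -/
def IsRepresentatives (S : Set QuadSpace.{u}) : Prop :=
  ∀ V : QuadSpace.{u}, ∃! W : QuadSpace.{u}, W ∈ S ∧ V.form.Equivalent W.form

/-- The product over `V ∈ S` of the categories of `𝔽₂[O(V)]`-modules. -/
abbrev ModuleProduct (S : Set QuadSpace.{u}) :=
  ∀ V : S, ModuleCat.{u} (MonoidAlgebra (ZMod 2) V.1.orthogonalGroup)

open Classical in
/-- The family of modules equal to `M` at `V` and zero elsewhere. -/
noncomputable def concentrated {S : Set QuadSpace.{u}} (V : S)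
    (M : ModuleCat.{u} (MonoidAlgebra (ZMod 2) V.1.orthogonalGroup)) : ModuleProduct S :=
  Function.update (fun _ => ModuleCat.of _ PUnit) V M

end Fiso

/-! Every span `[V ⟵ D ⟶ W]` is a restriction `res l` followed by an extension `ext r`, and `ext u ≫
res u = 𝟙` because morphisms are monic. Hence `idem α = res α ≫ ext α` is idempotent. The
idempotents of `V` commute, pullbacks being symmetric, and they are finitely many, `V` being a
finite set. The product of the `1 - F(idem α)` over proper `α` therefore projects `F(V)` onto its
primitive part, with complement the sum of the images of the proper idempotents.

Induction on dimension gives two dual facts: extensions of primitive elements span `F(V)`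
(`span_ext_primitive`), and an element is zero once the primitive parts of all its restrictions
vanish (`eq_zero_of_proj_res`). The first gives faithfulness. For fullness, equivariant maps between
primitive parts define a relation between `F(V)` and `G(V)`: the second fact makes it single-valued,
the first makes it total, and it is stable under all spans.

For essential surjectivity, an element of `F(V)` is encoded by the family `u ↦ proj (F(res u) x)`
over `u : W ⟶ V`, `W ∈ S`. So, given representations `N W`, the functor sends `V` to the families of
equivariant functions `(W ⟶ V) → N W` (`ofFamily`); its primitive elements are the families
supported on isometries, and evaluation at the identity recovers `N`.

An equivalence preserves simple objects, and a simple object in a product of module categories is a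
simple module placed at one index. -/

namespace QuadSpace

/-! ### Isometries and proper subobjects of quadratic spaces -/

variable {U V W : QuadSpace.{u}}

instance (f : V ⟶ W) : Mono f :=
  ⟨fun _ _ h => hom_ext fun x => f.injective (congrArg (fun k => k.toIsometry x) h)⟩

theorem isIso_of_surjective (f : V ⟶ W) (hf : Function.Surjective f.toIsometry) : IsIso f := by
  let e : V ≃ₗ[ZMod 2] W :=
    LinearEquiv.ofBijective f.toIsometry.toLinearMap ⟨f.injective, hf⟩
  have he : ∀ x, f.toIsometry (e.symm x) = x := fun x => e.apply_symm_apply x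
  refine ⟨⟨⟨⟨e.symm.toLinearMap, fun x => ?_⟩, e.symm.injective⟩, hom_ext fun x => ?_,
    hom_ext fun x => he x⟩⟩
  · change V.form (e.symm x) = W.form x
    rw [← f.toIsometry.map_app, he]
  · exact e.symm_apply_apply x

theorem surjective_of_isIso (f : V ⟶ W) [IsIso f] : Function.Surjective f.toIsometry := fun x =>
  ⟨(inv f).toIsometry x, congrArg (fun k : W ⟶ W => k.toIsometry x) (IsIso.inv_hom_id f)⟩

theorem surjective_comp {f : U ⟶ V} {g : V ⟶ W} (hf : Function.Surjective f.toIsometry)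
    (hg : Function.Surjective g.toIsometry) : Function.Surjective (f ≫ g).toIsometry :=
  hg.comp hf

theorem surjective_of_comp {f : U ⟶ V} {g : V ⟶ W}
    (h : Function.Surjective (f ≫ g).toIsometry) : Function.Surjective g.toIsometry :=
  Function.Surjective.of_comp (g := f.toIsometry) h

theorem surjective_left_of_comp {f : U ⟶ V} {g : V ⟶ W}
    (h : Function.Surjective (f ≫ g).toIsometry) : Function.Surjective f.toIsometry := fun x => by
  obtain ⟨y, hy⟩ := h (g.toIsometry x)
  exact ⟨y, g.injective hy⟩

theorem finrank_lt (f : V ⟶ W) (hf : ¬ Function.Surjective f.toIsometry) :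
    Module.finrank (ZMod 2) V < Module.finrank (ZMod 2) W := by
  refine lt_of_le_of_ne (LinearMap.finrank_le_finrank_of_injective
    (f := f.toIsometry.toLinearMap) f.injective) fun h => hf ?_
  exact (LinearMap.injective_iff_surjective_of_finrank_eq_finrank
    (f := f.toIsometry.toLinearMap) h).1 f.injective

/-- The isometry underlying a surjective endomorphism. -/
noncomputable def orthogonalOfSurjective (f : V ⟶ V) (hf : Function.Surjective f.toIsometry) :
    V.orthogonalGroup :=
  ⟨LinearEquiv.ofBijective f.toIsometry.toLinearMap ⟨f.injective, hf⟩, f.toIsometry.map_app⟩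

@[simp]
theorem orthogonalHom_orthogonalOfSurjective (f : V ⟶ V)
    (hf : Function.Surjective f.toIsometry) :
    orthogonalHom (orthogonalOfSurjective f hf) = f :=
  rfl

theorem orthogonalHom_injective : Function.Injective (orthogonalHom (V := V)) := fun _ _ e =>
  Subtype.ext (LinearEquiv.ext fun x => congrArg (fun k : V ⟶ V => k.toIsometry x) e)

theorem surjective_orthogonalHom (g : V.orthogonalGroup) :
    Function.Surjective (orthogonalHom g).toIsometry :=
  g.1.surjective

end QuadSpace

/-! ### Calculus of restrictions, extensions and idempotents -/

namespace Fiso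

open QuadSpace

variable {A B U V W X : QuadSpace.{u}}

theorem spanHom_comp {D D' P : QuadSpace.{u}} {l : D ⟶ A} {r : D ⟶ B} {l' : D' ⟶ B}
    {r' : D' ⟶ V} {p : P ⟶ D} {q : P ⟶ D'} (h : IsPullback p q r l') :
    spanHom l r ≫ spanHom l' r' = spanHom (p ≫ l) (q ≫ r') :=
  Sp.comp_cls h

theorem exists_spanHom (s : (Sp.mk V : Sp QuadSpace.{u}) ⟶ Sp.mk W) :
    ∃ (D : QuadSpace.{u}) (l : D ⟶ V) (r : D ⟶ W), s = spanHom l r := by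
  induction s using Quotient.inductionOn with | _ S =>
  exact ⟨S.apex, S.l, S.r, rfl⟩

theorem spanHom_eq_iff {D D' : QuadSpace.{u}} {l : D ⟶ V} {r : D ⟶ W} {l' : D' ⟶ V}
    {r' : D' ⟶ W} :
    spanHom l r = spanHom l' r' ↔ ∃ e : D ≅ D', e.hom ≫ l' = l ∧ e.hom ≫ r' = r := by
  refine ⟨fun h => ?_, fun ⟨e, h, h'⟩ => Sp.cls_eq e h h'⟩
  obtain ⟨i⟩ := Quotient.exact h
  exact ⟨⟨i.hom.hom, i.inv.hom, congrArg Span.Hom.hom i.hom_inv_id,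
    congrArg Span.Hom.hom i.inv_hom_id⟩, i.hom.hom_l, i.hom.hom_r⟩

/-- Restriction along `u : W ⟶ V`: the class of `[V ⟵ W ⟶ W]`. -/
abbrev res (u : W ⟶ V) : (Sp.mk V : Sp QuadSpace.{u}) ⟶ Sp.mk W := spanHom u (𝟙 W)

/-- Extension along `u : W ⟶ V`: the class of `[W ⟵ W ⟶ V]`. -/
abbrev ext (u : W ⟶ V) : (Sp.mk W : Sp QuadSpace.{u}) ⟶ Sp.mk V := spanHom (𝟙 W) u

theorem res_comp_ext (l : A ⟶ V) (r : A ⟶ W) : res l ≫ ext r = spanHom l r :=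
  (spanHom_comp (p := 𝟙 A) (q := 𝟙 A) (IsPullback.of_horiz_isIso ⟨by simp⟩)).trans (by simp)

theorem res_comp_res (u : W ⟶ V) (w : X ⟶ W) : res u ≫ res w = res (w ≫ u) :=
  (spanHom_comp (p := w) (q := 𝟙 X) (IsPullback.of_vert_isIso ⟨by simp⟩)).trans (by simp)

theorem ext_comp_ext (u : W ⟶ V) (w : V ⟶ X) : ext u ≫ ext w = ext (u ≫ w) :=
  (spanHom_comp (p := 𝟙 W) (q := u) (IsPullback.of_horiz_isIso ⟨by simp⟩)).trans (by simp)

theorem ext_comp_res (u : W ⟶ V) : ext u ≫ res u = 𝟙 _ :=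
  (spanHom_comp (IsKernelPair.id_of_mono u)).trans (by simp; rfl)

theorem res_injective {u w : W ⟶ V} (h : res u = res w) : u = w := by
  obtain ⟨e, h1, h2⟩ := spanHom_eq_iff.1 h
  rw [Category.comp_id] at h2
  rw [← h1, h2, Category.id_comp]

theorem idem_eq (α : A ⟶ V) : idem α = res α ≫ ext α := (res_comp_ext α α).symm

theorem idem_comp_res (u : W ⟶ V) : idem u ≫ res u = res u := by
  rw [idem_eq, Category.assoc, ext_comp_res, Category.comp_id]

theorem idem_comp_idem (α : A ⟶ V) : idem α ≫ idem α = idem α := by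
  rw [idem_eq, Category.assoc, ← Category.assoc (ext α), ext_comp_res, Category.id_comp]

theorem idem_comm (α : A ⟶ V) (β : B ⟶ V) : idem α ≫ idem β = idem β ≫ idem α := by
  rw [spanHom_comp (isPullback_pb α β), spanHom_comp (isPullback_pb α β).flip, pb_comm]

theorem idem_eq_of_isIso (e : A ⟶ B) [IsIso e] (β : B ⟶ V) : idem (e ≫ β) = idem β :=
  spanHom_eq_iff.2 ⟨asIso e, rfl, rfl⟩

/-- When the ranges agree, both projections of the pullback are isometries, so the two spans are
isomorphic. This bounds the number of idempotents by the number of subspaces. -/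
theorem idem_eq_of_range_eq {α : A ⟶ V} {β : B ⟶ V}
    (h : LinearMap.range α.toIsometry.toLinearMap = LinearMap.range β.toIsometry.toLinearMap) :
    idem α = idem β := by
  have h1 : IsIso (pbFst α β) := isIso_of_surjective _ fun x =>
    ⟨⟨x, show _ ∈ LinearMap.range β.toIsometry.toLinearMap from h ▸ ⟨x, rfl⟩⟩, rfl⟩
  have h2 : IsIso (pbSnd α β) := isIso_of_surjective _ fun y => by
    obtain ⟨x, hx⟩ : β.toIsometry y ∈ LinearMap.range α.toIsometry.toLinearMap :=
      h ▸ ⟨y, rfl⟩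
    have hx' : α.toIsometry x = β.toIsometry y := hx
    refine ⟨⟨x, y, hx'.symm⟩, β.injective ?_⟩
    exact (pbSndFun_spec α β _).trans hx'
  rw [← idem_eq_of_isIso (pbFst α β), pb_comm, idem_eq_of_isIso]

/-- A span is a restriction if its right leg is invertible, and otherwise factors through the
idempotent of a proper subobject. -/
theorem eq_res_or_factors (s : (Sp.mk V : Sp QuadSpace.{u}) ⟶ Sp.mk W) :
    (∃ w : W ⟶ V, s = res w) ∨
      ∃ (A : QuadSpace.{u}) (α : A ⟶ W), ¬ Function.Surjective α.toIsometry ∧ s = s ≫ idem α := by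
  obtain ⟨D, l, r, rfl⟩ := exists_spanHom s
  by_cases hr : Function.Surjective r.toIsometry
  · have := isIso_of_surjective r hr
    exact .inl ⟨inv r ≫ l, spanHom_eq_iff.2 ⟨asIso r, by simp, by simp⟩⟩
  -- The right leg is itself the proper subobject: `ext r ≫ res r = 𝟙` shows that `idem r` fixes the
  -- span.
  · refine .inr ⟨D, r, hr, ?_⟩
    rw [← res_comp_ext l r, idem_eq, Category.assoc, ← Category.assoc (ext r),
      ext_comp_res, Category.id_comp]

/-- The second factor of a composite that is a restriction is a restriction. -/
theorem exists_res_of_comp {s : (Sp.mk U : Sp QuadSpace.{u}) ⟶ Sp.mk V}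
    {t : (Sp.mk V : Sp QuadSpace.{u}) ⟶ Sp.mk W} {w : W ⟶ U} (h : s ≫ t = res w) :
    ∃ w' : W ⟶ V, t = res w' := by
  obtain ⟨D, l, r, rfl⟩ := exists_spanHom s
  obtain ⟨D', l', r', rfl⟩ := exists_spanHom t
  rw [spanHom_comp (isPullback_pb r l'), spanHom_eq_iff] at h
  obtain ⟨e, -, h2⟩ := h
  -- The right leg of the composite is the isomorphism `e` and it ends with `r'`.
  have hr' : Function.Surjective r'.toIsometry := by
    rw [Category.comp_id] at h2
    exact surjective_of_comp (h2 ▸ surjective_of_isIso e.hom)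
  have := isIso_of_surjective r' hr'
  exact ⟨inv r' ≫ l', spanHom_eq_iff.2 ⟨asIso r', by simp, by simp⟩⟩

/-- Composing with the idempotent of a proper subobject does not give the restriction along an
isomorphism. -/
theorem not_surjective_of_idem_comp {α : A ⟶ V} {t : (Sp.mk V : Sp QuadSpace.{u}) ⟶ Sp.mk W}
    {w : W ⟶ V} (h : idem α ≫ t = res w) (hα : ¬ Function.Surjective α.toIsometry) :
    ¬ Function.Surjective w.toIsometry := by
  obtain ⟨D', l', r', rfl⟩ := exists_spanHom t
  rw [spanHom_comp (isPullback_pb α l'), spanHom_eq_iff] at h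
  obtain ⟨e, h1, -⟩ := h
  intro hw
  exact hα (surjective_of_comp (h1 ▸ surjective_comp (surjective_of_isIso e.hom) hw))

/-- Reparametrizing the apex by `g` moves the isometry to the left leg and inverts it. The inverses
in the equivariance conditions below come from here. -/
theorem isom_eq_res (g : V.orthogonalGroup) : isom g = res (orthogonalHom g⁻¹) := by
  have e1 : orthogonalHom g ≫ orthogonalHom g⁻¹ = 𝟙 V :=
    hom_ext fun x => g.1.symm_apply_apply x
  have : IsIso (orthogonalHom g) := isIso_of_surjective _ (surjective_orthogonalHom g)
  exact spanHom_eq_iff.2 ⟨asIso (orthogonalHom g), e1, Category.comp_id _⟩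

end Fiso

/-! ### Projection onto the primitive part -/

/-- Finitely many commuting idempotents have a complementary projector: it is killed by all of
them, fixes the common kernel, and differs from the identity by the sum of the ranges. -/
theorem exists_projector_of_commuting_idempotents {R M : Type*} [Ring R] [AddCommGroup M]
    [Module R M] (s : Set (Module.End R M)) (hs : s.Finite)
    (hi : ∀ e ∈ s, e * e = e) (hc : ∀ e ∈ s, ∀ f ∈ s, e * f = f * e) :
    ∃ q : Module.End R M, (∀ e ∈ s, e * q = 0 ∧ q * e = 0) ∧
      (∀ x, (∀ e ∈ s, e x = 0) → q x = x) ∧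
      (∀ x, x - q x ∈ ⨆ e ∈ s, LinearMap.range e) ∧
      ∀ a, (∀ e ∈ s, a * e = e * a) → a * q = q * a := by
  induction s, hs using Set.Finite.induction_on with
  | empty => exact ⟨1, by simp, by simp, by simp, by simp⟩
  | @insert e s _ _ ih =>
    obtain ⟨q, h1, h2, h3, h4⟩ := ih (fun f hf => hi f (.inr hf))
      fun f hf g hg => hc f (.inr hf) g (.inr hg)
    have he := hi e (.inl rfl)
    have hq : e * q = q * e := h4 e fun f hf => hc e (.inl rfl) f (.inr hf)
    -- The projector is the product of the `1 - e`, built one factor at a time. The last clause of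
    -- the statement carries the induction: it makes the next idempotent commute with `q`.
    refine ⟨q * (1 - e), ?_, ?_, ?_, ?_⟩
    · rintro f (rfl | hf)
      · constructor
        · rw [← mul_assoc, hq, mul_assoc, mul_sub, mul_one, he, sub_self, mul_zero]
        · rw [mul_assoc, sub_mul, one_mul, he, sub_self, mul_zero]
      · constructor
        · rw [← mul_assoc, (h1 f hf).1, zero_mul]
        · rw [mul_assoc, sub_mul, one_mul, hc e (.inl rfl) f (.inr hf), mul_sub,
            ← mul_assoc, (h1 f hf).2, zero_mul, sub_zero]
    · intro x hx
      have hex : e x = 0 := hx e (.inl rfl)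
      simp [hex, h2 x fun f hf => hx f (.inr hf)]
    · intro x
      have hle : ⨆ f ∈ s, LinearMap.range f ≤ ⨆ f ∈ insert e s, LinearMap.range f :=
        biSup_mono fun _ => .inr
      have : x - (q * (1 - e)) x = (x - q x) + e (q x) := by
        have := LinearMap.congr_fun hq x
        simp only [Module.End.mul_apply] at this
        simp only [Module.End.mul_apply, LinearMap.sub_apply, Module.End.one_apply, map_sub, this]
        abel
      rw [this]
      exact add_mem (hle (h3 x)) (Submodule.mem_iSup_of_mem e
        (Submodule.mem_iSup_of_mem (.inl rfl) ⟨q x, rfl⟩))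
    · intro a ha
      have h5 := h4 a fun f hf => ha f (.inr hf)
      have h6 := ha e (.inl rfl)
      rw [← mul_assoc, h5, mul_assoc, mul_assoc, mul_sub, sub_mul, mul_one, one_mul, h6]

namespace Fiso

open QuadSpace

variable {A U V W : QuadSpace.{u}} {F G : Fiso.{u}}

theorem map_comp_apply {X Y Z : Sp QuadSpace.{u}} (F : Fiso.{u}) (s : X ⟶ Y) (t : Y ⟶ Z)
    (x : F.obj X) : (F.map (s ≫ t)).hom x = (F.map t).hom ((F.map s).hom x) := by
  rw [F.map_comp]; rfl

theorem map_id_apply {X : Sp QuadSpace.{u}} (F : Fiso.{u}) (x : F.obj X) :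
    (F.map (𝟙 X)).hom x = x := by
  rw [F.map_id]; rfl

theorem naturality_apply {X Y : Sp QuadSpace.{u}} (η : F ⟶ G) (s : X ⟶ Y) (x : F.obj X) :
    (η.app Y).hom ((F.map s).hom x) = (G.map s).hom ((η.app X).hom x) :=
  congrArg (fun k => k.hom x) (η.naturality s)

/-- The idempotents of the proper subobjects of `V`. -/
def properIdem (V : QuadSpace.{u}) : Set ((Sp.mk V : Sp QuadSpace.{u}) ⟶ Sp.mk V) :=
  {s | ∃ (A : QuadSpace.{u}) (α : A ⟶ V), ¬ Function.Surjective α.toIsometry ∧ s = idem α}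

theorem finite_properIdem (V : QuadSpace.{u}) : (properIdem V).Finite := by
  have : Finite V := Module.finite_of_finite (ZMod 2)
  have : Finite (Submodule (ZMod 2) V) :=
    Finite.of_injective _ (SetLike.coe_injective (A := Submodule (ZMod 2) V))
  choose A α _ h2 using fun s : properIdem V => s.2
  have : Finite (properIdem V) := Finite.of_injective
    (fun s => LinearMap.range (α s).toIsometry.toLinearMap) fun s t h =>
    Subtype.ext ((h2 s).trans ((idem_eq_of_range_eq h).trans (h2 t).symm))
  exact Set.toFinite _

theorem exists_proj (V : QuadSpace.{u}) (F : Fiso.{u}) :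
    ∃ q : F.obj ⟨V⟩ →ₗ[ZMod 2] F.obj ⟨V⟩, (∀ x, q x ∈ primitive V F) ∧
      (∀ (A : QuadSpace.{u}) (α : A ⟶ V), ¬ Function.Surjective α.toIsometry →
        ∀ x, q ((F.map (idem α)).hom x) = 0) ∧
      (∀ x ∈ primitive V F, q x = x) ∧
      ∀ x, x - q x ∈ ⨆ e ∈ properIdem V, LinearMap.range (F.map e).hom := by
  obtain ⟨q, h1, h2, h3, -⟩ := exists_projector_of_commuting_idempotents
    ((fun e => (F.map e).hom) '' properIdem V) ((finite_properIdem V).image _)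
    (by
      rintro _ ⟨_, ⟨A, α, -, rfl⟩, rfl⟩
      ext x
      exact (map_comp_apply F _ _ x).symm.trans (by rw [idem_comp_idem]))
    (by
      rintro _ ⟨_, ⟨A, α, -, rfl⟩, rfl⟩ _ ⟨_, ⟨B, β, -, rfl⟩, rfl⟩
      ext x
      exact (map_comp_apply F _ _ x).symm.trans (by rw [idem_comm, map_comp_apply]; rfl))
  refine ⟨q, fun x A α hα => ?_, fun A α hα x => ?_, fun x hx => h2 x ?_, fun x => ?_⟩
  · exact LinearMap.congr_fun (h1 _ ⟨_, ⟨A, α, hα, rfl⟩, rfl⟩).1 x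
  · exact LinearMap.congr_fun (h1 _ ⟨_, ⟨A, α, hα, rfl⟩, rfl⟩).2 x
  · rintro _ ⟨_, ⟨A, α, hα, rfl⟩, rfl⟩
    exact hx A α hα
  · have := h3 x
    rwa [iSup_image] at this

/-- The projection of `F(V)` onto its primitive part that kills the images of the idempotents of
the proper subobjects. -/
noncomputable def proj (V : QuadSpace.{u}) (F : Fiso.{u}) :
    F.obj ⟨V⟩ →ₗ[ZMod 2] primitive V F :=
  (exists_proj V F).choose.codRestrict _ (exists_proj V F).choose_spec.1

theorem proj_idem {α : A ⟶ V} (hα : ¬ Function.Surjective α.toIsometry) (x : F.obj ⟨V⟩) :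
    proj V F ((F.map (idem α)).hom x) = 0 :=
  Subtype.ext ((exists_proj V F).choose_spec.2.1 A α hα x)

theorem proj_of_mem {x : F.obj ⟨V⟩} (hx : x ∈ primitive V F) : proj V F x = ⟨x, hx⟩ :=
  Subtype.ext ((exists_proj V F).choose_spec.2.2.1 x hx)

theorem sub_proj_mem (x : F.obj ⟨V⟩) :
    x - proj V F x ∈ ⨆ e ∈ properIdem V, LinearMap.range (F.map e).hom :=
  (exists_proj V F).choose_spec.2.2.2 x

end Fiso

/-! ### Generation and detection by primitive parts; full faithfulness -/

namespace Fiso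

open QuadSpace

variable {A U V W : QuadSpace.{u}} {F G : Fiso.{u}} {S : Set QuadSpace.{u}}

theorem equivalent_of_surjective (f : V ⟶ W) (hf : Function.Surjective f.toIsometry) :
    V.form.Equivalent W.form :=
  ⟨{ LinearEquiv.ofBijective f.toIsometry.toLinearMap ⟨f.injective, hf⟩ with
    map_app' := f.toIsometry.map_app }⟩

theorem IsRepresentatives.exists_surjective (hS : IsRepresentatives S) (V : QuadSpace.{u}) :
    ∃ (W : S) (f : W.1 ⟶ V), Function.Surjective f.toIsometry := by
  obtain ⟨W, ⟨hW, ⟨e⟩⟩, -⟩ := hS V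
  exact ⟨⟨W, hW⟩, ⟨e.symm.toIsometry, e.symm.injective⟩, e.symm.surjective⟩

theorem IsRepresentatives.eq_of_equivalent (hS : IsRepresentatives S) {V W : S}
    (h : V.1.form.Equivalent W.1.form) : V = W :=
  Subtype.ext ((hS V.1).unique ⟨V.2, .refl _⟩ ⟨W.2, h⟩)

theorem IsRepresentatives.eq_of_surjective (hS : IsRepresentatives S) {V W : S}
    (f : V.1 ⟶ W.1) (hf : Function.Surjective f.toIsometry) : V = W :=
  hS.eq_of_equivalent (equivalent_of_surjective f hf)

/-- A proper subobject of `W` stays proper in `V`, and restricting `x` to it factors through its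
idempotent on `V`. -/
theorem res_mem_primitive (f : W ⟶ V) {x : F.obj ⟨V⟩}
    (hx : x ∈ primitive V F) : (F.map (res f)).hom x ∈ primitive W F := by
  intro A α hα
  have hα' : ¬ Function.Surjective (α ≫ f).toIsometry := fun h => hα (surjective_left_of_comp h)
  have h0 : (F.map (res (α ≫ f))).hom x = 0 := by
    rw [← idem_comp_res, map_comp_apply, hx A _ hα', map_zero]
  rw [← map_comp_apply, idem_eq, ← Category.assoc, res_comp_res, map_comp_apply, h0, map_zero]

theorem ext_res_of_surjective {f : W ⟶ V} (hf : Function.Surjective f.toIsometry)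
    (x : F.obj ⟨V⟩) : (F.map (ext f)).hom ((F.map (res f)).hom x) = x := by
  have := isIso_of_surjective f hf
  rw [← map_comp_apply, res_comp_ext]
  have h : spanHom f f = 𝟙 (Sp.mk V) := by
    have := idem_eq_of_isIso f (𝟙 V)
    rwa [Category.comp_id] at this
  rw [h, map_id_apply]

/-- The values of `F` are spanned by the extensions of primitive elements. -/
theorem span_ext_primitive (hS : IsRepresentatives S) (F : Fiso.{u}) (V : QuadSpace.{u}) :
    ⨆ (W : S) (f : W.1 ⟶ V), (primitive W.1 F).map (F.map (ext f)).hom = ⊤ := by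
  induction hn : Module.finrank (ZMod 2) V using Nat.strong_induction_on generalizing V with
  | _ n ih =>
  subst hn
  rw [eq_top_iff]
  rintro x -
  rw [← sub_add_cancel x (proj V F x)]
  -- The non-primitive part is a sum of extensions from proper subobjects, which have smaller
  -- dimension. The primitive part is carried to the representative of `V` by an isometry.
  refine add_mem ((iSup₂_le_iff.2 fun e he => ?_ :
    (⨆ e ∈ properIdem V, LinearMap.range (F.map e).hom) ≤ _) (sub_proj_mem x)) ?_
  · obtain ⟨A, α, hα, rfl⟩ := he
    rintro _ ⟨y, rfl⟩
    have hy : (F.map (res α)).hom y ∈ (⊤ : Submodule (ZMod 2) (F.obj ⟨A⟩)) := trivial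
    rw [← ih _ (finrank_lt α hα) A rfl] at hy
    have hy' := Submodule.mem_map_of_mem (f := (F.map (ext α)).hom) hy
    rw [idem_eq, map_comp_apply]
    refine (?_ : Submodule.map _ _ ≤ _) hy'
    simp only [Submodule.map_iSup]
    refine iSup₂_le fun W f => ?_
    rintro _ ⟨_, ⟨z, hz, rfl⟩, rfl⟩
    refine Submodule.mem_iSup_of_mem W (Submodule.mem_iSup_of_mem (f ≫ α) ⟨z, hz, ?_⟩)
    rw [← ext_comp_ext, map_comp_apply]
  · obtain ⟨W, f, hf⟩ := hS.exists_surjective V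
    exact Submodule.mem_iSup_of_mem W (Submodule.mem_iSup_of_mem f
      ⟨_, res_mem_primitive f (proj V F x).2, ext_res_of_surjective hf _⟩)

/-- An element is determined by the primitive parts of its restrictions. -/
theorem eq_zero_of_proj_res (hS : IsRepresentatives S) {V : QuadSpace.{u}} (x : F.obj ⟨V⟩)
    (hx : ∀ (W : S) (f : W.1 ⟶ V), proj W.1 F ((F.map (res f)).hom x) = 0) : x = 0 := by
  induction hn : Module.finrank (ZMod 2) V using Nat.strong_induction_on generalizing V with
  | _ n ih =>
  subst hn
  -- By induction every proper restriction of `x` vanishes, so `x` is primitive and `proj` loses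
  -- nothing on the representative of `V`.
  have hp : x ∈ primitive V F := fun A α hα => by
    have : (F.map (res α)).hom x = 0 := by
      refine ih _ (finrank_lt α hα) _ (fun W f => ?_) rfl
      rw [← map_comp_apply, res_comp_res]
      exact hx W _
    rw [idem_eq, map_comp_apply, this, map_zero]
  obtain ⟨W, f, hf⟩ := hS.exists_surjective V
  have := hx W f
  rw [proj_of_mem (res_mem_primitive f hp)] at this
  have h0 : (F.map (res f)).hom x = 0 := congrArg Subtype.val this
  rw [← ext_res_of_surjective hf x, h0, map_zero]

/-- A natural transformation is determined by its values on primitive elements. -/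
theorem natTrans_ext (hS : IsRepresentatives S) {η θ : F ⟶ G}
    (h : ∀ (W : S), ∀ x ∈ primitive W.1 F, (η.app ⟨W.1⟩).hom x = (θ.app ⟨W.1⟩).hom x) :
    η = θ := by
  ext ⟨V⟩ x
  have hx : x ∈ (⊤ : Submodule (ZMod 2) (F.obj ⟨V⟩)) := trivial
  rw [← span_ext_primitive hS] at hx
  refine (iSup₂_le fun W f => ?_ : _ ≤ LinearMap.eqLocus (η.app ⟨V⟩).hom (θ.app ⟨V⟩).hom) hx
  rintro _ ⟨z, hz, rfl⟩
  change (η.app ⟨V⟩).hom _ = (θ.app ⟨V⟩).hom _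
  rw [naturality_apply, naturality_apply, h W z hz]

section Full

variable (φ : ∀ W : S, primitive W.1 F →ₗ[ZMod 2] primitive W.1 G)

/-- The elements `x` and `y` correspond to each other under the family `φ` of maps between
primitive parts. -/
def Corresponds (V : QuadSpace.{u}) (x : F.obj ⟨V⟩) (y : G.obj ⟨V⟩) : Prop :=
  ∀ (W : S) (f : W.1 ⟶ V),
    proj W.1 G ((G.map (res f)).hom y) = φ W (proj W.1 F ((F.map (res f)).hom x))

variable {φ}

theorem Corresponds.add {x x' : F.obj ⟨V⟩} {y y' : G.obj ⟨V⟩} (h : Corresponds φ V x y)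
    (h' : Corresponds φ V x' y') : Corresponds φ V (x + x') (y + y') := fun W f => by
  simp only [map_add, h W f, h' W f]

theorem Corresponds.smul {x : F.obj ⟨V⟩} {y : G.obj ⟨V⟩} (c : ZMod 2)
    (h : Corresponds φ V x y) : Corresponds φ V (c • x) (c • y) := fun W f => by
  simp only [map_smul, h W f]

/-- Detection by restrictions makes the relation single-valued. Linearity and naturality of the map
it defines both reduce to this uniqueness. -/
theorem Corresponds.eq (hS : IsRepresentatives S) {x : F.obj ⟨V⟩} {y y' : G.obj ⟨V⟩}
    (h : Corresponds φ V x y) (h' : Corresponds φ V x y') : y = y' := by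
  refine sub_eq_zero.1 (eq_zero_of_proj_res hS _ fun W f => ?_)
  rw [map_sub, map_sub, h W f, h' W f, sub_self]

/-- After `s`, restriction along `f` is either again a restriction, where the hypothesis applies, or
ends in a proper idempotent, which both projections kill. -/
theorem Corresponds.map {x : F.obj ⟨V⟩} {y : G.obj ⟨V⟩} (h : Corresponds φ V x y)
    (s : (Sp.mk V : Sp QuadSpace.{u}) ⟶ Sp.mk U) :
    Corresponds φ U ((F.map s).hom x) ((G.map s).hom y) := fun W f => by
  obtain ⟨w, hw⟩ | ⟨A, α, hα, hs⟩ := eq_res_or_factors (s ≫ res f)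
  · simp only [← map_comp_apply, hw]
    exact h W w
  · simp only [← map_comp_apply]
    rw [hs, map_comp_apply G _ (idem α), map_comp_apply F _ (idem α), proj_idem hα,
      proj_idem hα, map_zero]

/-- Restricting a primitive element along a proper subobject gives zero. Any other `f` is an
isometry between members of `S`, hence an element of `O(V)`, and equivariance applies. -/
theorem corresponds_of_primitive (hS : IsRepresentatives S)
    (hφ : ∀ (W : S) (g : W.1.orthogonalGroup) (x : primitive W.1 F),
      φ W (primitiveRep W.1 F g x) = primitiveRep W.1 G g (φ W x))
    (V : S) (x : primitive V.1 F) : Corresponds φ V.1 x.1 (φ V x).1 := fun W f => by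
  by_cases hf : Function.Surjective f.toIsometry
  · obtain rfl := hS.eq_of_surjective f hf
    have e : res f = isom (orthogonalOfSurjective f hf)⁻¹ := by
      rw [isom_eq_res, inv_inv, orthogonalHom_orthogonalOfSurjective]
    rw [proj_of_mem (res_mem_primitive f (φ W x).2), proj_of_mem (res_mem_primitive f x.2)]
    simp only [e]
    exact (hφ W (orthogonalOfSurjective f hf)⁻¹ x).symm
  · have h0 : ∀ {H : Fiso.{u}} (y : primitive V.1 H), (H.map (res f)).hom y.1 = 0 := fun y => by
      rw [← idem_comp_res, map_comp_apply, y.2 _ f hf, map_zero]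
    rw [h0, h0, map_zero, map_zero, map_zero]

/-- The elements having a partner form a submodule, which contains the spanning set of extensions of
primitive elements. -/
theorem exists_corresponds (hS : IsRepresentatives S)
    (hφ : ∀ (W : S) (g : W.1.orthogonalGroup) (x : primitive W.1 F),
      φ W (primitiveRep W.1 F g x) = primitiveRep W.1 G g (φ W x))
    (V : QuadSpace.{u}) (x : F.obj ⟨V⟩) : ∃ y, Corresponds φ V x y := by
  let K : Submodule (ZMod 2) (F.obj ⟨V⟩) :=
    { carrier := {x | ∃ y, Corresponds φ V x y}
      zero_mem' := ⟨0, fun W f => by simp only [map_zero]⟩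
      add_mem' := fun ⟨y, h⟩ ⟨y', h'⟩ => ⟨y + y', h.add h'⟩
      smul_mem' := fun c _ ⟨y, h⟩ => ⟨c • y, h.smul c⟩ }
  have hx : x ∈ (⊤ : Submodule (ZMod 2) (F.obj ⟨V⟩)) := trivial
  rw [← span_ext_primitive hS] at hx
  refine (iSup₂_le fun W f => ?_ : _ ≤ K) hx
  rintro _ ⟨z, hz, rfl⟩
  exact ⟨_, (corresponds_of_primitive hS hφ W ⟨z, hz⟩).map (ext f)⟩

/-- A family of equivariant maps between primitive parts comes from a natural transformation. -/
theorem exists_natTrans (hS : IsRepresentatives S)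
    (hφ : ∀ (W : S) (g : W.1.orthogonalGroup) (x : primitive W.1 F),
      φ W (primitiveRep W.1 F g x) = primitiveRep W.1 G g (φ W x)) :
    ∃ η : F ⟶ G, ∀ (W : S) (x : primitive W.1 F), (η.app ⟨W.1⟩).hom x.1 = φ W x := by
  choose t ht using fun (V : QuadSpace.{u}) => exists_corresponds hS hφ V
  refine ⟨{ app := fun V => ModuleCat.ofHom
              { toFun := t V.obj
                map_add' := fun x y => (ht _ _).eq hS ((ht _ x).add (ht _ y))
                map_smul' := fun c x => (ht _ _).eq hS ((ht _ x).smul c) }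
            naturality := fun V W s => ?_ }, fun W x => ?_⟩
  · ext x
    exact (ht _ _).eq hS ((ht _ x).map s)
  · exact (ht _ _).eq hS (corresponds_of_primitive hS hφ W x)

end Full

/-- The functor sending `F` to the family of its primitive parts, as representations. -/
noncomputable abbrev primitiveFamily (S : Set QuadSpace.{u}) :
    Fiso.{u} ⥤ ∀ V : S, Rep.{u} (ZMod 2) V.1.orthogonalGroup :=
  Functor.pi' fun V : S => primitiveRepFunctor V.1

theorem primitiveFamily_faithful (hS : IsRepresentatives S) : (primitiveFamily S).Faithful where
  map_injective {F G η θ} h := natTrans_ext hS fun W x hx => by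
    have h1 : (primitiveRepFunctor W.1).map η = (primitiveRepFunctor W.1).map θ := congrFun h W
    have h2 := congrArg (fun k : (primitiveRepFunctor W.1).obj F ⟶ (primitiveRepFunctor W.1).obj G
      => k.hom (⟨x, hx⟩ : primitive W.1 F)) h1
    exact congrArg Subtype.val h2

theorem primitiveFamily_full (hS : IsRepresentatives S) : (primitiveFamily S).Full where
  map_surjective {F G} ψ := by
    obtain ⟨η, hη⟩ := exists_natTrans (F := F) (G := G) (φ := fun W => (ψ W).hom.toLinearMap) hS
      fun W g x => Rep.hom_comm_apply (ψ W) g x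
    refine ⟨η, funext fun W => Rep.hom_ext ?_⟩
    ext x
    exact Subtype.ext (hη W x)

end Fiso

/-! ### Essential surjectivity: the functor of equivariant families -/

namespace Fiso

open QuadSpace

variable {A U V W : QuadSpace.{u}} {S : Set QuadSpace.{u}}

/-- An isometry class is determined by a form on some `𝔽₂ⁿ`. Smallness brings the families indexed
by `S` back into universe `u`. -/
theorem IsRepresentatives.small (hS : IsRepresentatives S) : Small.{u} S := by
  let b (V : QuadSpace.{u}) : (Fin (Module.finrank (ZMod 2) V) → ZMod 2) ≃ₗ[ZMod 2] V :=
    (Module.finBasis (ZMod 2) V).equivFun.symm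
  let q (V : S) : Σ n : ℕ, QuadraticForm (ZMod 2) (Fin n → ZMod 2) :=
    ⟨_, V.1.form.comp (b V.1).toLinearMap⟩
  refine small_of_injective (f := q) fun V W h => hS.eq_of_equivalent ?_
  -- A general `p` avoids transporting forms along an equality of dimensions.
  have key : ∀ p : Σ n : ℕ, QuadraticForm (ZMod 2) (Fin n → ZMod 2), q V = p →
      QuadraticMap.Equivalent V.1.form p.2 := by
    rintro _ rfl
    exact ⟨{ (b V.1).symm with
      map_app' := fun x => congrArg V.1.form ((b V.1).apply_symm_apply x) }⟩
  exact (key _ h).trans ⟨{ b W.1 with map_app' := fun x => rfl }⟩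

variable (N : ∀ W : S, Rep.{u} (ZMod 2) W.1.orthogonalGroup)

/-- The families of equivariant functions on the sets of morphisms `W ⟶ V`, for `W ∈ S`. -/
def equivariantFamilies (V : QuadSpace.{u}) :
    Submodule (ZMod 2) (∀ W : S, (W.1 ⟶ V) → N W) where
  -- The inverse appears because `res (orthogonalHom g)` equals `isom g⁻¹`.
  carrier := {f | ∀ (W : S) (g : W.1.orthogonalGroup) (u : W.1 ⟶ V),
    f W (orthogonalHom g ≫ u) = (N W).ρ g⁻¹ (f W u)}
  zero_mem' _ _ _ := (map_zero _).symm
  add_mem' hf hf' W g u := by simp only [Pi.add_apply, hf W g u, hf' W g u, map_add]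
  smul_mem' c f hf W g u := by simp only [Pi.smul_apply, hf W g u, map_smul]

variable {N}

open Classical in
/-- The family obtained from `f` along a span: the value at `u` is the value of `f` at `w` if `s`
restricts along `u` to the restriction along `w`, and zero if there is no such `w`. -/
noncomputable def transport (s : (Sp.mk V : Sp QuadSpace.{u}) ⟶ Sp.mk U)
    (f : ∀ W : S, (W.1 ⟶ V) → N W) (W : S) (u : W.1 ⟶ U) : N W :=
  -- Without such a `w`, the span `s ≫ res u` ends in a proper idempotent of `W`, which kills
  -- primitive parts; hence the value zero.
  if h : ∃ w : W.1 ⟶ V, s ≫ res u = res w then f W h.choose else 0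

/-- The choice of `w` is immaterial by `res_injective`. -/
theorem transport_of_eq {s : (Sp.mk V : Sp QuadSpace.{u}) ⟶ Sp.mk U}
    (f : ∀ W : S, (W.1 ⟶ V) → N W) {W : S} {u : W.1 ⟶ U} {w : W.1 ⟶ V}
    (h : s ≫ res u = res w) : transport s f W u = f W w := by
  have h' : ∃ w : W.1 ⟶ V, s ≫ res u = res w := ⟨w, h⟩
  rw [transport, dif_pos h', res_injective (h'.choose_spec.symm.trans h)]

theorem transport_of_not {s : (Sp.mk V : Sp QuadSpace.{u}) ⟶ Sp.mk U}
    (f : ∀ W : S, (W.1 ⟶ V) → N W) {W : S} {u : W.1 ⟶ U}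
    (h : ¬ ∃ w : W.1 ⟶ V, s ≫ res u = res w) : transport s f W u = 0 :=
  dif_neg h

theorem orthogonalHom_inv_comp {V W : QuadSpace.{u}} (g : V.orthogonalGroup) (u : V ⟶ W) :
    orthogonalHom g⁻¹ ≫ orthogonalHom g ≫ u = u :=
  hom_ext fun x => congrArg u.toIsometry (g.1.apply_symm_apply x)

theorem transport_mem {f : ∀ W : S, (W.1 ⟶ V) → N W} (hf : f ∈ equivariantFamilies N V)
    (s : (Sp.mk V : Sp QuadSpace.{u}) ⟶ Sp.mk U) :
    transport s f ∈ equivariantFamilies N U := by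
  intro W g u
  by_cases h : ∃ w : W.1 ⟶ V, s ≫ res u = res w
  · obtain ⟨w, hw⟩ := h
    rw [transport_of_eq f hw, ← hf, transport_of_eq]
    rw [← res_comp_res, ← Category.assoc, hw, res_comp_res]
  · rw [transport_of_not f h, map_zero, transport_of_not]
    rintro ⟨w, hw⟩
    refine h ⟨orthogonalHom g⁻¹ ≫ w, ?_⟩
    rw [← res_comp_res, ← hw, Category.assoc, res_comp_res, orthogonalHom_inv_comp]

theorem transport_id (f : ∀ W : S, (W.1 ⟶ V) → N W) : transport (𝟙 (Sp.mk V)) f = f :=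
  funext fun _ => funext fun _ => transport_of_eq f (Category.id_comp _)

/-- The default value zero is compatible with composition: by `exists_res_of_comp`, if `s ≫ t ≫ res
u` is a restriction then `t ≫ res u` already is one. -/
theorem transport_comp (f : ∀ W : S, (W.1 ⟶ V) → N W)
    (s : (Sp.mk V : Sp QuadSpace.{u}) ⟶ Sp.mk U) (t : (Sp.mk U : Sp QuadSpace.{u}) ⟶ Sp.mk A) :
    transport (s ≫ t) f = transport t (transport s f) := by
  funext W u
  by_cases h : ∃ w : W.1 ⟶ V, (s ≫ t) ≫ res u = res w
  · obtain ⟨w, hw⟩ := h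
    rw [transport_of_eq f hw]
    rw [Category.assoc] at hw
    obtain ⟨w', hw'⟩ := exists_res_of_comp hw
    rw [transport_of_eq _ hw', transport_of_eq]
    rw [← hw', hw]
  · rw [transport_of_not f h]
    by_cases h' : ∃ w : W.1 ⟶ U, t ≫ res u = res w
    · obtain ⟨w, hw⟩ := h'
      rw [transport_of_eq _ hw, transport_of_not]
      rwa [← hw, ← Category.assoc]
    · rw [transport_of_not _ h']

theorem transport_add (s : (Sp.mk V : Sp QuadSpace.{u}) ⟶ Sp.mk U)
    (f f' : ∀ W : S, (W.1 ⟶ V) → N W) :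
    transport s (f + f') = transport s f + transport s f' := by
  funext W u
  by_cases h : ∃ w : W.1 ⟶ V, s ≫ res u = res w
  · obtain ⟨w, hw⟩ := h
    simp only [Pi.add_apply, transport_of_eq _ hw]
  · simp only [Pi.add_apply, transport_of_not _ h, add_zero]

theorem transport_smul (s : (Sp.mk V : Sp QuadSpace.{u}) ⟶ Sp.mk U) (c : ZMod 2)
    (f : ∀ W : S, (W.1 ⟶ V) → N W) : transport s (c • f) = c • transport s f := by
  funext W u
  by_cases h : ∃ w : W.1 ⟶ V, s ≫ res u = res w
  · obtain ⟨w, hw⟩ := h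
    simp only [Pi.smul_apply, transport_of_eq _ hw]
  · simp only [Pi.smul_apply, transport_of_not _ h, smul_zero]

/-- Transport as a linear map between spaces of equivariant families. -/
noncomputable def transportHom (N : ∀ W : S, Rep.{u} (ZMod 2) W.1.orthogonalGroup)
    (s : (Sp.mk V : Sp QuadSpace.{u}) ⟶ Sp.mk U) :
    equivariantFamilies N V →ₗ[ZMod 2] equivariantFamilies N U where
  toFun f := ⟨transport s f.1, transport_mem f.2 s⟩
  map_add' f f' := Subtype.ext (transport_add s f.1 f'.1)
  map_smul' c f := Subtype.ext (transport_smul s c f.1)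

section OfFamily

variable [Small.{u} S]

variable (N) in
/-- A small model of the space of equivariant families. -/
noncomputable def shrinkFamilies (V : QuadSpace.{u}) :
    Shrink.{u} (equivariantFamilies N V) ≃ₗ[ZMod 2] equivariantFamilies N V :=
  Shrink.linearEquiv (ZMod 2) _

variable (N) in
/-- The functor with primitive parts `N`. -/
noncomputable def ofFamily : Fiso.{u} where
  obj V := ModuleCat.of (ZMod 2) (Shrink.{u} (equivariantFamilies N V.obj))
  map {V W} s := ModuleCat.ofHom ((shrinkFamilies N W.obj).symm.toLinearMap ∘ₗ
    transportHom N s ∘ₗ (shrinkFamilies N V.obj).toLinearMap)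
  map_id V := ModuleCat.hom_ext <| LinearMap.ext fun x =>
    (LinearEquiv.symm_apply_eq _).2 (Subtype.ext (transport_id _))
  map_comp s t := ModuleCat.hom_ext <| LinearMap.ext fun x =>
    (LinearEquiv.symm_apply_eq _).2 (Subtype.ext (by simp [transportHom, transport_comp]))

variable (N) in
/-- The elements of `ofFamily N` as equivariant families. -/
noncomputable def toFamily (V : QuadSpace.{u}) :
    (ofFamily N).obj ⟨V⟩ ≃ₗ[ZMod 2] equivariantFamilies N V :=
  shrinkFamilies N V

theorem toFamily_map (s : (Sp.mk V : Sp QuadSpace.{u}) ⟶ Sp.mk U) (x : (ofFamily N).obj ⟨V⟩) :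
    (toFamily N U (((ofFamily N).map s).hom x)).1 = transport s (toFamily N V x).1 :=
  congrArg Subtype.val ((shrinkFamilies N U).apply_symm_apply
    (transportHom N s (toFamily N V x)))

/-- The value at `u` is unchanged by `idem u`, so primitivity kills it for proper `u`. Conversely, a
proper idempotent only picks up values at non-surjective morphisms. -/
theorem mem_primitive_ofFamily {x : (ofFamily N).obj ⟨V⟩} :
    x ∈ primitive V (ofFamily N) ↔ ∀ (W : S) (u : W.1 ⟶ V),
      ¬ Function.Surjective u.toIsometry → (toFamily N V x).1 W u = 0 := by
  constructor
  · intro hx W u hu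
    rw [← transport_of_eq (s := idem u) (toFamily N V x).1 (idem_comp_res u), ← toFamily_map,
      hx _ u hu, map_zero]
    rfl
  · intro hx A α hα
    refine (toFamily N V).injective (Subtype.ext ?_)
    rw [toFamily_map, map_zero]
    funext W u
    by_cases h : ∃ w : W.1 ⟶ V, idem α ≫ res u = res w
    · obtain ⟨w, hw⟩ := h
      rw [transport_of_eq _ hw, hx W w (not_surjective_of_idem_comp hw hα)]
      rfl
    · rw [transport_of_not _ h]
      rfl

/-- Evaluation of primitive elements of `ofFamily N` at the identity. -/
noncomputable def evalId (N : ∀ W : S, Rep.{u} (ZMod 2) W.1.orthogonalGroup) (V : S) :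
    (primitiveRep V.1 (ofFamily N)).IntertwiningMap (N V).ρ where
  toFun x := (toFamily N V.1 x.1).1 V (𝟙 V.1)
  map_add' x y := by simp
  map_smul' c x := by simp
  isIntertwining' g := LinearMap.ext fun x => by
    have h : isom g ≫ res (𝟙 V.1) = res (orthogonalHom g⁻¹ ≫ 𝟙 V.1) := by
      rw [isom_eq_res, res_comp_res, Category.id_comp, Category.comp_id]
    have h1 := (toFamily N V.1 x.1).2 V g⁻¹ (𝟙 V.1)
    rw [inv_inv] at h1
    refine Eq.trans ?_ h1
    refine (congrFun (congrFun (toFamily_map (isom g) x.1) V) (𝟙 V.1)).trans ?_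
    exact transport_of_eq _ h

/-- A primitive family lives on isometries `W ⟶ V`. These force `W = V` and form a single orbit of
the identity under `O(V)`. -/
theorem evalId_injective (hS : IsRepresentatives S) (V : S) :
    Function.Injective (evalId N V) := by
  rw [injective_iff_map_eq_zero]
  intro x hx
  refine Subtype.ext ((toFamily N V.1).injective (Subtype.ext ?_))
  change _ = (toFamily N V.1 0).1
  rw [map_zero]
  funext W u
  by_cases hu : Function.Surjective u.toIsometry
  · obtain rfl := hS.eq_of_surjective u hu
    have h := (toFamily N W.1 x.1).2 W (orthogonalOfSurjective u hu) (𝟙 W.1)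
    rw [Category.comp_id, orthogonalHom_orthogonalOfSurjective] at h
    rw [h]
    exact (congrArg _ hx).trans (map_zero _)
  · exact mem_primitive_ofFamily.1 x.2 W u hu

open Classical in
theorem evalId_surjective (V : S) : Function.Surjective (evalId N V) := by
  intro n
  -- Equivariance and the value `n` at the identity force this formula on isometries; primitivity
  -- forces zero elsewhere.
  let k (u : V.1 ⟶ V.1) : N V :=
    if hu : Function.Surjective u.toIsometry then (N V).ρ (orthogonalOfSurjective u hu)⁻¹ n else 0
  let f : ∀ W : S, (W.1 ⟶ V.1) → N W :=
    Pi.single (M := fun W : S => (W.1 ⟶ V.1) → N W) V k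
  have hfV : f V = k := Pi.single_eq_same ..
  have hfW : ∀ W, W ≠ V → f W = 0 := fun W h => Pi.single_eq_of_ne h _
  have hf : f ∈ equivariantFamilies N V.1 := by
    intro W g u
    by_cases h : W = V
    · subst h
      rw [hfV]
      by_cases hu : Function.Surjective u.toIsometry
      · have hgu : Function.Surjective (orthogonalHom g ≫ u).toIsometry :=
          surjective_comp (surjective_orthogonalHom g) hu
        have e : orthogonalOfSurjective (orthogonalHom g ≫ u) hgu =
            orthogonalOfSurjective u hu * g := orthogonalHom_injective rfl
        simp only [k, dif_pos hu, dif_pos hgu, e, mul_inv_rev, map_mul, Module.End.mul_apply]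
      · have hgu : ¬ Function.Surjective (orthogonalHom g ≫ u).toIsometry :=
          fun h => hu (surjective_of_comp h)
        simp only [k, dif_neg hu, dif_neg hgu, map_zero]
    · rw [hfW W h]
      exact (map_zero _).symm
  refine ⟨⟨(toFamily N V.1).symm ⟨f, hf⟩, mem_primitive_ofFamily.2 fun W u hu => ?_⟩, ?_⟩
  · rw [LinearEquiv.apply_symm_apply]
    change f W u = 0
    by_cases h : W = V
    · subst h
      rw [hfV]
      exact dif_neg hu
    · rw [hfW W h]
      rfl
  · change (toFamily N V.1 ((toFamily N V.1).symm ⟨f, hf⟩)).1 V (𝟙 V.1) = n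
    rw [LinearEquiv.apply_symm_apply]
    change f V (𝟙 V.1) = n
    have h1 : Function.Surjective (𝟙 V.1 : V.1 ⟶ V.1).toIsometry := Function.surjective_id
    have e : orthogonalOfSurjective (𝟙 V.1) h1 = 1 := orthogonalHom_injective rfl
    rw [hfV]
    simp only [k, dif_pos h1, e, inv_one, map_one, Module.End.one_apply]

end OfFamily

theorem primitiveFamily_essSurj (hS : IsRepresentatives S) : (primitiveFamily S).EssSurj where
  mem_essImage N := by
    have := hS.small
    exact ⟨ofFamily N, ⟨Pi.isoMk fun V => Rep.mkIso
      ((evalId N V).ofBijective ⟨evalId_injective hS V, evalId_surjective V⟩)⟩⟩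

end Fiso

/-! ### Simple objects in a product of module categories -/

section ProductZero

variable {I : Type*} {C : I → Type*} [∀ i, Category (C i)]

/-- Zero morphisms in a product of categories. -/
instance piHasZeroMorphisms [∀ i, HasZeroMorphisms (C i)] : HasZeroMorphisms (∀ i, C i) where
  zero _ _ := ⟨fun _ => 0⟩
  comp_zero _ _ := funext fun _ => comp_zero
  zero_comp _ _ _ _ := funext fun _ => zero_comp

theorem mono_of_forall_mono {X Y : ∀ i, C i} (f : X ⟶ Y) (h : ∀ i, Mono (f i)) : Mono f :=
  ⟨fun _ _ e => funext fun i => (h i).right_cancellation _ _ (congrFun e i)⟩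

/-- The kernels of the components assemble into one object of the product, so a single cancellation
against zero makes them all trivial. -/
theorem mono_apply [∀ i, Preadditive (C i)] [∀ i, HasKernels (C i)] {X Y : ∀ i, C i} (f : X ⟶ Y)
    [Mono f] (i : I) : Mono (f i) := by
  let k : (fun i => kernel (f i)) ⟶ X := fun i => kernel.ι (f i)
  let z : (fun i => kernel (f i)) ⟶ X := fun i => 0
  have h : k = z := (cancel_mono f).1 (funext fun i => by
    change kernel.ι (f i) ≫ f i = 0 ≫ f i
    simp)
  exact Preadditive.mono_of_kernel_zero (congrFun h i)

end ProductZero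

namespace Fiso

open QuadSpace

variable {S : Set QuadSpace.{u}}

theorem concentrated_self (V : S)
    (M : ModuleCat.{u} (MonoidAlgebra (ZMod 2) V.1.orthogonalGroup)) : concentrated V M V = M :=
  by
  classical exact Function.update_self ..

theorem isZero_concentrated {V W : S} (h : W ≠ V)
    (M : ModuleCat.{u} (MonoidAlgebra (ZMod 2) V.1.orthogonalGroup)) :
    IsZero (concentrated V M W) := by
  rw [show concentrated V M W = ModuleCat.of _ PUnit by classical exact Function.update_of_ne h ..]
  exact ModuleCat.isZero_of_subsingleton _

theorem simple_concentrated (V : S)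
    (M : ModuleCat.{u} (MonoidAlgebra (ZMod 2) V.1.orthogonalGroup)) [Simple M] :
    Simple (concentrated V M) where
  mono_isIso_iff_nonzero {Y} f _ := by
    have hs : Simple (concentrated V M V) := by rwa [concentrated_self]
    have hm : ∀ W, Mono (f W) := mono_apply f
    have h0 : f = 0 ↔ f V = 0 := by
      refine ⟨fun h => congrFun h V, fun h => funext fun W => ?_⟩
      by_cases hW : W = V
      · subst hW
        exact h
      · exact (isZero_concentrated hW M).eq_of_tgt _ _
    rw [isIso_pi_iff, ne_eq, h0, ← ne_eq, ← Simple.mono_isIso_iff_nonzero (f V)]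
    refine ⟨fun h => h V, fun h W => ?_⟩
    by_cases hW : W = V
    · subst hW
      exact h
    · have hz := isZero_concentrated hW M
      -- Away from `V` the target is zero, and so is the source of a monomorphism into it.
      exact IsZero.isIso ((IsZero.iff_id_eq_zero _).2 ((cancel_mono (f W)).1
        (hz.eq_of_tgt _ _))) hz _

section FromConcentrated

variable {V : S} {M : ModuleCat.{u} (MonoidAlgebra (ZMod 2) V.1.orthogonalGroup)}
  {X : ModuleProduct S}

/-- The `eqToHom` is needed because the component at `V` of the updated family equals `M` only
propositionally. -/
theorem exists_fromConcentrated (g : M ⟶ X V) :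
    ∃ f : concentrated V M ⟶ X, f V = eqToHom (concentrated_self V M) ≫ g := by
  classical
  refine ⟨fun W => if h : V = W then by subst h; exact eqToHom (concentrated_self V M) ≫ g else 0,
    ?_⟩
  simp

theorem mono_fromConcentrated (f : concentrated V M ⟶ X) [Mono (f V)] : Mono f :=
  mono_of_forall_mono f fun W => by
    by_cases hW : W = V
    · subst hW
      infer_instance
    · exact ⟨fun _ _ _ => (isZero_concentrated hW M).eq_of_tgt _ _⟩

theorem fromConcentrated_eq_zero_iff (f : concentrated V M ⟶ X) : f = 0 ↔ f V = 0 := by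
  refine ⟨fun h => congrFun h V, fun h => funext fun W => ?_⟩
  by_cases hW : W = V
  · subst hW
    exact h
  · exact (isZero_concentrated hW M).eq_of_src _ _

theorem isIso_fromConcentrated (hX : ∀ W, W ≠ V → IsZero (X W)) (f : concentrated V M ⟶ X)
    [IsIso (f V)] : IsIso f := by
  rw [isIso_pi_iff]
  intro W
  by_cases hW : W = V
  · subst hW
    infer_instance
  · exact (isZero_concentrated hW M).isIso (hX W hW) _

/-- A simple family of modules is concentrated at one index. -/
theorem exists_iso_concentrated (X : ModuleProduct S) [Simple X] :
    ∃ V : S, Simple (X V) ∧ Nonempty (X ≅ concentrated V (X V)) := by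
  obtain ⟨V, hV⟩ : ∃ V, ¬ IsZero (X V) := by
    by_contra! h
    exact id_nonzero X (funext fun V => (h V).eq_of_src _ _)
  -- Extending the identity of a nonzero component by zero gives a nonzero monomorphism into the
  -- simple `X`, hence an isomorphism.
  obtain ⟨f, hf⟩ := exists_fromConcentrated (𝟙 (X V))
  rw [Category.comp_id] at hf
  have : IsIso (f V) := hf ▸ inferInstance
  have := mono_fromConcentrated f
  have : IsIso f := isIso_of_mono_of_nonzero fun h => hV (by
    have h1 : 𝟙 (concentrated V (X V) V) = 0 := by
      rw [← cancel_mono (f V), (fromConcentrated_eq_zero_iff f).1 h, comp_zero, comp_zero]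
    rw [concentrated_self] at h1
    exact (IsZero.iff_id_eq_zero _).2 h1)
  have hX : ∀ W, W ≠ V → IsZero (X W) := fun W hW =>
    (isZero_concentrated hW _).of_iso (Pi.isoApp (asIso f) W).symm
  refine ⟨V, ⟨fun {N} g _ => ?_⟩, ⟨(asIso f).symm⟩⟩
  -- A subobject of `X V` extends by zero to a subobject of `X`; being zero or invertible is the
  -- same for both, so simplicity descends.
  obtain ⟨k, hk⟩ := exists_fromConcentrated g
  have : Mono (k V) := hk ▸ inferInstance
  have := mono_fromConcentrated k
  have h0 : k = 0 ↔ g = 0 := by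
    rw [fromConcentrated_eq_zero_iff, hk]
    refine ⟨fun h => ?_, fun h => by rw [h, comp_zero]⟩
    rwa [← cancel_epi (eqToHom (concentrated_self V N)), comp_zero]
  have h1 : IsIso k ↔ IsIso g := by
    constructor
    · intro _
      have := (isIso_pi_iff k).1 inferInstance V
      rw [hk] at this
      exact IsIso.of_isIso_comp_left (eqToHom (concentrated_self V N)) g
    · intro _
      have : IsIso (k V) := hk ▸ inferInstance
      exact isIso_fromConcentrated hX k
  rw [← h1, Simple.mono_isIso_iff_nonzero k, ne_eq, h0]

theorem nonempty_iso_of_concentrated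
    {N : ModuleCat.{u} (MonoidAlgebra (ZMod 2) V.1.orthogonalGroup)}
    (i : concentrated V M ≅ concentrated V N) : Nonempty (M ≅ N) :=
  ⟨(eqToIso (concentrated_self V M)).symm ≪≫ Pi.isoApp i V ≪≫ eqToIso (concentrated_self V N)⟩

theorem eq_of_concentrated_iso {W : S}
    {N : ModuleCat.{u} (MonoidAlgebra (ZMod 2) W.1.orthogonalGroup)} [Simple M]
    (i : concentrated V M ≅ concentrated W N) : V = W := by
  by_contra h
  have hz := (isZero_concentrated h N).of_iso (Pi.isoApp i V)
  rw [concentrated_self] at hz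
  exact Simple.not_isZero M hz

end FromConcentrated

/-! ### The equivalence and the classification of simple functors -/

/-- The functor to the product of the categories of modules is an equivalence. -/
theorem isEquivalence_pi_primitiveFunctor (hS : IsRepresentatives S) :
    (Functor.pi' fun V : S => primitiveFunctor.{u} V.1).IsEquivalence := by
  have : (primitiveFamily S).IsEquivalence :=
    { faithful := primitiveFamily_faithful hS
      full := primitiveFamily_full hS
      essSurj := primitiveFamily_essSurj hS }
  -- The second factor is, at each index, the equivalence between representations and modules over
  -- the group algebra.
  exact inferInstanceAs (primitiveFamily S ⋙ Functor.pi fun V : S =>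
    Rep.toModuleMonoidAlgebra (k := ZMod 2) (G := V.1.orthogonalGroup)).IsEquivalence

end Fiso

theorem theorem4p2 (S : Set QuadSpace.{u}) (hS : Fiso.IsRepresentatives S) :
    ∃ e : Fiso.{u} ≌ Fiso.ModuleProduct S,
      Nonempty (e.functor ≅ Functor.pi' fun V : S => Fiso.primitiveFunctor V.1) ∧
      (∀ (V : S) (M : ModuleCat.{u} (MonoidAlgebra (ZMod 2) V.1.orthogonalGroup)),
        Simple M → Simple (e.inverse.obj (Fiso.concentrated V M))) ∧
      (∀ F : Fiso.{u}, Simple F →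
        ∃! V : S, ∃ M : ModuleCat.{u} (MonoidAlgebra (ZMod 2) V.1.orthogonalGroup),
          Simple M ∧ Nonempty (F ≅ e.inverse.obj (Fiso.concentrated V M))) ∧
      (∀ (V : S) (M N : ModuleCat.{u} (MonoidAlgebra (ZMod 2) V.1.orthogonalGroup)),
        Nonempty (e.inverse.obj (Fiso.concentrated V M) ≅
          e.inverse.obj (Fiso.concentrated V N)) → Nonempty (M ≅ N)) := by
  have := Fiso.isEquivalence_pi_primitiveFunctor hS
  let e := (Functor.pi' fun V : S => Fiso.primitiveFunctor.{u} V.1).asEquivalence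
  refine ⟨e, ⟨Iso.refl _⟩, fun V M _ => ?_, fun F _ => ?_, fun V M N ⟨i⟩ => ?_⟩
  · have := Fiso.simple_concentrated V M
    exact simple_obj e.inverse _
  · have := simple_obj e.functor F
    obtain ⟨V, hV, ⟨i⟩⟩ := Fiso.exists_iso_concentrated (e.functor.obj F)
    refine ⟨V, ⟨_, hV, ⟨e.unitIso.app F ≪≫ e.inverse.mapIso i⟩⟩, ?_⟩
    rintro W ⟨M, hM, ⟨j⟩⟩
    -- Full faithfulness of the inverse reduces uniqueness of `V` to comparing concentrated
    -- families.
    exact Fiso.eq_of_concentrated_iso (e.inverse.preimageIso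
      (j.symm ≪≫ e.unitIso.app F ≪≫ e.inverse.mapIso i))
  · exact Fiso.nonempty_iso_of_concentrated (e.inverse.preimageIso i)
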